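/- Let $(\Delta,\mathcal D,\mathbb P)$ be a probability space, $\mathcal X\subset\mathbb R^{n_x}$, $c\in\mathbb R^{n_x}$ and $g:\mathcal X\times\Delta\to\mathbb R$. For $m\ge 1$ and a multisample $(\delta_1,\dots,\delta_m)\in\Delta^m$ consider the scenario program $$\mathcal P_1[\{\delta_i\}_{i=1}^m]:\quad \min_{x\in\mathcal X} c^{T}x\quad\text{subject to } g(x,\delta_i)\le 0,\ i=1,\dots,m .$$ Assume that $\mathcal X$ is convex, that $g(\cdot,\delta)$ is convex for every $\delta\in\Delta$, and that for every $m\ge 1$ and every $(\delta_1,\dots,\delta_m)\in\Delta^m$ the feasibility region of $\mathcal P_1[\{\delta_i\}_{i=1}^m]$ has non-empty interior and the program has a unique minimizer $x_m=x_m(\delta_1,\dots,\delta_m)$. Assume also that for every $m\ge 1$ the set $\{(\delta_1,\dots,\delta_m,\delta)\in\Delta^{m}\times\Delta : g(x_m(\delta_1,\dots,\delta_m),\delta)>0\}$ is measurable. The $k$-th constraint $g(x,\delta_k)\le 0$ is called a support constraint if its removal strictly decreases the optimal value of the program; constraints are counted by their index $k$. Let $\zeta\ge 0$ be an integer such that,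 for every $m\ge\max(\zeta,1)$, with $\mathbb P^m$-probability one $\mathcal P_1[\{\delta_i\}_{i=1}^m]$ has exactly $\zeta$ support constraints. Then, for every $m\ge\max(\zeta,1)$ and every $\epsilon\in(0,1)$, $$\mathbb P^m\Big\{(\delta_1,\dots,\delta_m)\in\Delta^m:\ \mathbb P\big(\delta\in\Delta:\ g(x_m,\delta)>0\big)>\epsilon\Big\}=\sum_{i=0}^{\zeta-1}\binom{m}{i}\epsilon^i(1-\epsilon)^{m-i}.$$ -/

import Mathlib

open MeasureTheory

namespace Scenario

/-- The feasibility region `{x ∈ X : g(x, δᵢ) ≤ 0 for all i}` of the scenario program with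
samples `ω = (δᵢ)`, indexed by an arbitrary type `ι`. -/
def feasible {n : ℕ} {Δ ι : Type*} (X : Set (EuclideanSpace ℝ (Fin n)))
    (g : EuclideanSpace ℝ (Fin n) → Δ → ℝ) (ω : ι → Δ) : Set (EuclideanSpace ℝ (Fin n)) :=
  {x | x ∈ X ∧ ∀ i, g x (ω i) ≤ 0}

/-- `x` is a minimizer of `cᵀ x` over the feasibility region. -/
def IsMinimizer {n : ℕ} {Δ ι : Type*} (X : Set (EuclideanSpace ℝ (Fin n)))
    (c : EuclideanSpace ℝ (Fin n)) (g : EuclideanSpace ℝ (Fin n) → Δ → ℝ) (ω : ι → Δ)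
    (x : EuclideanSpace ℝ (Fin n)) : Prop :=
  x ∈ feasible X g ω ∧ ∀ y ∈ feasible X g ω, inner ℝ c x ≤ inner ℝ c y

/-- The optimal value of the scenario program, as an extended real (the program left after
removing a constraint may be unbounded below). -/
noncomputable def optValue {n : ℕ} {Δ ι : Type*} (X : Set (EuclideanSpace ℝ (Fin n)))
    (c : EuclideanSpace ℝ (Fin n)) (g : EuclideanSpace ℝ (Fin n) → Δ → ℝ) (ω : ι → Δ) : EReal :=
  ⨅ x ∈ feasible X g ω, ((inner ℝ c x : ℝ) : EReal)

/-- The `k`-th constraint is a support constraint: removing it improves (strictly decreases) the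
optimal value. Constraints are counted by index, so equal samples give distinct constraints. -/
def IsSupportConstraint {n : ℕ} {Δ ι : Type*} (X : Set (EuclideanSpace ℝ (Fin n)))
    (c : EuclideanSpace ℝ (Fin n)) (g : EuclideanSpace ℝ (Fin n) → Δ → ℝ) (ω : ι → Δ)
    (k : ι) : Prop :=
  optValue X c g (fun j : {j : ι // j ≠ k} => ω j) < optValue X c g ω

/-- The standing assumption on the convex scenario program: convexity, and, for every multisample
of size `m ≥ 1`, a feasibility region with non-empty interior and a unique minimizer. -/
structure ConvexAssumption {n : ℕ} {Δ : Type*} (X : Set (EuclideanSpace ℝ (Fin n)))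
    (c : EuclideanSpace ℝ (Fin n)) (g : EuclideanSpace ℝ (Fin n) → Δ → ℝ) : Prop where
  convex_domain : Convex ℝ X
  convex_constraint : ∀ δ, ConvexOn ℝ X (fun x => g x δ)
  interior_nonempty : ∀ m : ℕ, 1 ≤ m → ∀ ω : Fin m → Δ, (interior (feasible X g ω)).Nonempty
  existsUnique_minimizer : ∀ m : ℕ, 1 ≤ m → ∀ ω : Fin m → Δ, ∃! x, IsMinimizer X c g ω x

end Scenario

/-! The satisfaction probability of m samples is the probability that a fresh constraint holds at
x_m. For ζ ≥ 1, almost surely exactly one set of ζ indices has a subprogram minimizer obeying the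
other m - ζ constraints, and that minimizer is x_m (`ae_existsUnique_support`, from the
combinatorial `value_eq_iff_eq_essential`). Given those ζ samples, each other constraint holds
independently with their satisfaction probability. Summing over index sets, the law for m samples is
C(m, ζ) t^(m - ζ) F(dt), with F the law for ζ samples (`measureReal_satisfaction_mem`).

Total mass 1 for every m ≥ ζ gives all moments of F. On [0, 1] they determine F, which thus has
density ζ (1 - t)^(ζ - 1) (`map_satisfaction_eq`). Integrating over t < 1 - ε yields the binomial
tail (`integral_binomialTail`). For ζ = 0, dropping one of m + 1 constraints almost surely costs
nothing, so x_m almost surely has violation probability zero. -/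

namespace Scenario


/-! ### Monotone set functions with a constant number of essential elements -/

/-- If every set of at least `ζ` indices has exactly `ζ` essential elements for a monotone set
function `v`, then the sets of `ζ` indices that attain the full value are exactly the set of
essential elements of the full index set. -/
theorem value_eq_iff_eq_essential {ι β : Type*} [Fintype ι] [DecidableEq ι] [LinearOrder β]
    {v : Finset ι → β} (hv : Monotone v) {ζ : ℕ} (hι : ζ ≤ Fintype.card ι)
    (h : ∀ J : Finset ι, ζ ≤ J.card → (J.filter fun k => v (J.erase k) < v J).card = ζ)
    {J : Finset ι} (hJ : J.card = ζ) :
    v J = v Finset.univ ↔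
      J = Finset.univ.filter fun k => v (Finset.univ.erase k) < v Finset.univ := by
  set E : Finset ι := Finset.univ.filter fun k => v (Finset.univ.erase k) < v Finset.univ with hE
  have hEc : E.card = ζ := h Finset.univ (by simpa using hι)
  constructor
  · intro hJv
    refine (Finset.eq_of_subset_of_card_le (fun k hk => ?_) (by rw [hJ, hEc])).symm
    by_contra hkJ
    have hle : v J ≤ v (Finset.univ.erase k) :=
      hv fun j hj => Finset.mem_erase.2 ⟨fun hjk => hkJ (hjk ▸ hj), Finset.mem_univ _⟩
    have := (Finset.mem_filter.1 hk).2
    exact absurd (hJv ▸ hle) (not_le.2 this)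
  · rintro rfl
    -- Delete the elements outside `E` one by one. Each is inessential, so the value is kept;
    -- essential elements stay essential, and the count `ζ` prevents new ones.
    have key : ∀ K : Finset ι, E ⊆ Kᶜ → v Kᶜ = v Finset.univ ∧
        (Kᶜ.filter fun k => v (Kᶜ.erase k) < v Kᶜ) = E := by
      intro K
      induction K using Finset.induction_on with
      | empty => intro _; simp [hE]
      | insert a K ha ih =>
        intro hsub
        rw [Finset.compl_insert] at hsub ⊢
        obtain ⟨h1, h2⟩ := ih (hsub.trans (Finset.erase_subset _ _))
        have haE : a ∉ E := fun haE => Finset.notMem_erase a _ (hsub haE)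
        have haK : a ∈ Kᶜ := Finset.mem_compl.2 ha
        have heq : v (Kᶜ.erase a) = v Kᶜ := by
          refine le_antisymm (hv (Finset.erase_subset _ _)) (not_lt.1 fun hlt => haE ?_)
          rw [← h2]
          exact Finset.mem_filter.2 ⟨haK, hlt⟩
        refine ⟨heq.trans h1, ?_⟩
        symm
        refine Finset.eq_of_subset_of_card_le (fun k hk => ?_) ?_
        · refine Finset.mem_filter.2 ⟨hsub hk, ?_⟩
          have hk' := hk
          rw [← h2] at hk'
          rw [heq]
          refine lt_of_le_of_lt (hv ?_) (Finset.mem_filter.1 hk').2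
          exact Finset.erase_subset_erase _ (Finset.erase_subset _ _)
        · rw [hEc, h]
          rw [← hEc]
          exact Finset.card_le_card hsub
    have := (key Eᶜ (by simp)).1
    simpa using this

/-! ### Subprograms -/

section Subprogram

variable {n : ℕ} {Δ ι κ : Type*} {X : Set (EuclideanSpace ℝ (Fin n))}
  {c : EuclideanSpace ℝ (Fin n)} {g : EuclideanSpace ℝ (Fin n) → Δ → ℝ}

theorem feasible_subset_of_range_subset {ω : ι → Δ} {ω' : κ → Δ}
    (h : Set.range ω' ⊆ Set.range ω) : feasible X g ω ⊆ feasible X g ω' := by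
  rintro x ⟨hxX, hx⟩
  refine ⟨hxX, fun i => ?_⟩
  obtain ⟨j, hj⟩ := h ⟨i, rfl⟩
  exact hj ▸ hx j

theorem optValue_le_of_range_subset {ω : ι → Δ} {ω' : κ → Δ}
    (h : Set.range ω' ⊆ Set.range ω) : optValue X c g ω' ≤ optValue X c g ω :=
  biInf_mono fun _ hx => feasible_subset_of_range_subset h hx

/-- Only the set of imposed constraints matters, so index types can be exchanged freely. -/
theorem optValue_eq_of_range_eq {ω : ι → Δ} {ω' : κ → Δ}
    (h : Set.range ω' = Set.range ω) : optValue X c g ω' = optValue X c g ω :=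
  le_antisymm (optValue_le_of_range_subset h.le) (optValue_le_of_range_subset h.ge)

theorem IsMinimizer.optValue_eq {ω : ι → Δ} {x : EuclideanSpace ℝ (Fin n)}
    (hx : IsMinimizer X c g ω x) : optValue X c g ω = ((inner ℝ c x : ℝ) : EReal) :=
  le_antisymm (iInf₂_le x hx.1) (le_iInf₂ fun y hy => EReal.coe_le_coe_iff.2 (hx.2 y hy))

/-- A minimizer of a subprogram with a unique minimizer is feasible for the whole program exactly
when both have the same value, and then it is the minimizer of the whole program. -/
theorem IsMinimizer.feasible_iff_optValue_eq {ω : ι → Δ} {ω' : κ → Δ}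
    (h : Set.range ω' ⊆ Set.range ω) {x y : EuclideanSpace ℝ (Fin n)}
    (hx : IsMinimizer X c g ω x) (hy : IsMinimizer X c g ω' y)
    (hu : ∀ z, IsMinimizer X c g ω' z → z = y) :
    y ∈ feasible X g ω ↔ optValue X c g ω' = optValue X c g ω := by
  constructor
  · intro hyω
    refine le_antisymm (optValue_le_of_range_subset h) ?_
    rw [hy.optValue_eq]
    exact iInf₂_le y hyω
  · intro hv
    rw [hx.optValue_eq, hy.optValue_eq, EReal.coe_eq_coe_iff] at hv
    have : x = y := hu x ⟨feasible_subset_of_range_subset h hx.1, fun z hz => hv ▸ hy.2 z hz⟩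
    exact this ▸ hx.1

theorem IsMinimizer.of_feasible {ω : ι → Δ} {ω' : κ → Δ}
    (h : Set.range ω' ⊆ Set.range ω) {y : EuclideanSpace ℝ (Fin n)}
    (hy : IsMinimizer X c g ω' y) (hyω : y ∈ feasible X g ω) : IsMinimizer X c g ω y :=
  ⟨hyω, fun z hz => hy.2 z (feasible_subset_of_range_subset h hz)⟩

/-- The value of the subprogram whose constraints have their index in `J`. -/
noncomputable def subValue (X : Set (EuclideanSpace ℝ (Fin n))) (c : EuclideanSpace ℝ (Fin n))
    (g : EuclideanSpace ℝ (Fin n) → Δ → ℝ) (ω : ι → Δ) (J : Finset ι) : EReal :=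
  optValue X c g fun j : J => ω j

theorem subValue_mono (ω : ι → Δ) : Monotone (subValue X c g ω) := by
  intro J K h
  refine optValue_le_of_range_subset ?_
  rintro _ ⟨j, rfl⟩
  exact ⟨⟨j, h j.2⟩, rfl⟩

theorem subValue_image [Fintype κ] [DecidableEq ι] (ω : ι → Δ) (e : κ → ι) (K : Finset κ) :
    subValue X c g ω (K.image e) = subValue X c g (ω ∘ e) K := by
  refine optValue_eq_of_range_eq ?_
  ext δ
  simp

theorem subValue_univ [Fintype ι] (ω : ι → Δ) :
    subValue X c g ω Finset.univ = optValue X c g ω := by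
  refine optValue_eq_of_range_eq ?_
  ext δ
  simp

theorem isSupportConstraint_iff [Fintype ι] [DecidableEq ι] (ω : ι → Δ) (k : ι) :
    IsSupportConstraint X c g ω k ↔
      subValue X c g ω (Finset.univ.erase k) < subValue X c g ω Finset.univ := by
  have : subValue X c g ω (Finset.univ.erase k) =
      optValue X c g (fun j : {j : ι // j ≠ k} => ω j) := by
    refine optValue_eq_of_range_eq ?_
    ext δ
    simp
  rw [IsSupportConstraint, this, subValue_univ]

/-- Transfers the count assumed for programs indexed by `Fin m` to subprograms of a larger
multisample. -/
theorem ncard_isSupportConstraint_comp [Fintype ι] [DecidableEq ι] [Fintype κ] [DecidableEq κ]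
    (ω : ι → Δ) {e : κ → ι} (he : Function.Injective e) {J : Finset ι}
    (hJ : Finset.univ.image e = J) :
    {k | IsSupportConstraint X c g (ω ∘ e) k}.ncard =
      (J.filter fun k => subValue X c g ω (J.erase k) < subValue X c g ω J).card := by
  subst hJ
  rw [← Set.ncard_coe_finset, ← Set.ncard_image_of_injective _ he]
  congr 1
  ext i
  simp only [Set.mem_image, Set.mem_ofPred_eq, isSupportConstraint_iff, Finset.coe_filter,
    Finset.mem_image, Finset.mem_univ, true_and]
  have key : ∀ k, subValue X c g ω ((Finset.univ.image e).erase (e k)) =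
      subValue X c g (ω ∘ e) (Finset.univ.erase k) := fun k => by
    rw [← Finset.image_erase he, subValue_image]
  constructor
  · rintro ⟨k, hk, rfl⟩
    exact ⟨⟨k, rfl⟩, by rwa [key, subValue_image]⟩
  · rintro ⟨⟨k, rfl⟩, hk⟩
    exact ⟨k, by rwa [key, subValue_image] at hk, rfl⟩

end Subprogram


/-! ### Product measures -/

section Product

variable {Δ : Type*} [MeasurableSpace Δ] (P : Measure Δ) [IsProbabilityMeasure P]

theorem map_pi_comp_injective {ι κ : Type*} [Fintype ι] [Fintype κ] {e : κ → ι}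
    (he : Function.Injective e) :
    (Measure.pi fun _ : ι => P).map (fun ω => ω ∘ e) = Measure.pi fun _ : κ => P := by
  have h := (ProbabilityTheory.iIndepFun_pi (μ := fun _ : ι => P) (X := fun _ => id)
    fun _ => aemeasurable_id).precomp he
  have h' := (ProbabilityTheory.iIndepFun_iff_map_fun_eq_pi_map
    (fun i => (measurable_pi_apply (e i)).aemeasurable)).1 h
  have h2 : ∀ i, (Measure.pi fun _ : ι => P).map (fun ω => ω (e i)) = P := fun i =>
    (measurePreserving_eval (fun _ : ι => P) (e i)).map_eq
  simp only [h2] at h'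
  exact h'

theorem ae_pi_comp_injective {ι κ : Type*} [Fintype ι] [Fintype κ] {e : κ → ι}
    (he : Function.Injective e) {p : (κ → Δ) → Prop}
    (hp : ∀ᵐ ω ∂(Measure.pi fun _ : κ => P), p ω) :
    ∀ᵐ ω ∂(Measure.pi fun _ : ι => P), p (ω ∘ e) := by
  rw [← map_pi_comp_injective P he] at hp
  exact ae_of_ae_map (measurable_pi_lambda _ fun i => measurable_pi_apply (e i)).aemeasurable hp

/-- Conditionally on the samples indexed by `I`, the other samples are independent of law `P`. -/
theorem measure_pi_forall_notMem {m k : ℕ} {I : Finset (Fin m)} (hI : I.card = k)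
    {A : Set ((Fin k → Δ) × Δ)} (hA : MeasurableSet A)
    {S : Set (Fin k → Δ)} (hS : MeasurableSet S) :
    (Measure.pi fun _ : Fin m => P).real
      {ω | ω ∘ I.orderEmbOfFin hI ∈ S ∧ ∀ j ∉ I, (ω ∘ I.orderEmbOfFin hI, ω j) ∈ A} =
      ∫ a in S, P.real {δ | (a, δ) ∈ A} ^ (m - k) ∂(Measure.pi fun _ : Fin k => P) := by
  have hIc : Iᶜ.card = m - k := by rw [Finset.card_compl, hI, Fintype.card_fin]
  set σ : Fin k ⊕ Fin (m - k) ≃ Fin m := finSumEquivOfFinset hI hIc with hσ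
  set T : Set ((Fin k → Δ) × (Fin (m - k) → Δ)) :=
    {p | p.1 ∈ S ∧ ∀ j, (p.1, p.2 j) ∈ A} with hT
  have hTm : MeasurableSet T := by
    have : T = (Prod.fst ⁻¹' S) ∩ ⋂ j, (fun p : (Fin k → Δ) × (Fin (m - k) → Δ) => (p.1, p.2 j)) ⁻¹' A := by
      ext p; simp [hT]
    rw [this]
    refine (measurable_fst hS).inter (MeasurableSet.iInter fun j => ?_)
    exact (by fun_prop : Measurable fun p : (Fin k → Δ) × (Fin (m - k) → Δ) => (p.1, p.2 j)) hA
  have hset : {ω : Fin m → Δ | ω ∘ I.orderEmbOfFin hI ∈ S ∧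
      ∀ j ∉ I, (ω ∘ I.orderEmbOfFin hI, ω j) ∈ A} =
      (fun ω => ω ∘ σ) ⁻¹' (MeasurableEquiv.sumPiEquivProdPi (fun _ => Δ) ⁻¹' T) := by
    have hr : ∀ j, j ∉ I ↔ j ∈ Set.range (Iᶜ.orderEmbOfFin hIc) := fun j => by simp
    ext ω
    simp only [hr, Set.forall_mem_range]
    rfl
  have hmp : MeasurePreserving (MeasurableEquiv.sumPiEquivProdPi (fun _ : Fin k ⊕ Fin (m - k) => Δ))
      (Measure.pi fun _ => P) ((Measure.pi fun _ => P).prod (Measure.pi fun _ => P)) :=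
    measurePreserving_sumPiEquivProdPi _
  have hq : Measurable fun a : Fin k → Δ => P {δ | (a, δ) ∈ A} := measurable_measure_prodMk_left hA
  have hmeas : (Measure.pi fun _ : Fin m => P)
      {ω | ω ∘ I.orderEmbOfFin hI ∈ S ∧ ∀ j ∉ I, (ω ∘ I.orderEmbOfFin hI, ω j) ∈ A} =
      ∫⁻ a in S, P {δ | (a, δ) ∈ A} ^ (m - k) ∂(Measure.pi fun _ : Fin k => P) := by
    rw [hset, ← Measure.map_apply (by fun_prop) (hmp.measurable hTm),
      map_pi_comp_injective P σ.injective, hmp.measure_preimage hTm.nullMeasurableSet,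
      Measure.prod_apply hTm, ← lintegral_indicator hS]
    refine lintegral_congr fun a => ?_
    by_cases ha : a ∈ S
    · rw [Set.indicator_of_mem ha]
      -- With `a` fixed, the section is a box, whose measure is a power.
      have : Prod.mk a ⁻¹' T = Set.univ.pi fun _ : Fin (m - k) => {δ | (a, δ) ∈ A} := by
        ext b; simp [hT, ha]
      rw [this, Measure.pi_pi]
      simp
    · rw [Set.indicator_of_notMem ha]
      have : Prod.mk a ⁻¹' T = ∅ := by
        ext b; simp [hT, ha]
      rw [this, measure_empty]
  rw [Measure.real, hmeas, ← integral_toReal (hq.pow_const _).aemeasurable]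
  · simp [Measure.real]
  · exact Filter.Eventually.of_forall fun a => ENNReal.pow_lt_top (measure_lt_top _ _)

end Product

/-! ### The Hausdorff moment problem on the unit interval -/

/-- Moments fix the integrals of polynomials, which by Weierstrass are uniformly dense in the
continuous functions on [0, 1]. -/
theorem measure_ext_of_moments {μ ν : Measure ℝ} [IsFiniteMeasure μ] [IsFiniteMeasure ν]
    (hμ : ∀ᵐ t ∂μ, t ∈ Set.Icc (0 : ℝ) 1) (hν : ∀ᵐ t ∂ν, t ∈ Set.Icc (0 : ℝ) 1)
    (h : ∀ k : ℕ, ∫ t, t ^ k ∂μ = ∫ t, t ^ k ∂ν) : μ = ν := by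
  have hint : ∀ {ρ : Measure ℝ} [IsFiniteMeasure ρ], (∀ᵐ t ∂ρ, t ∈ Set.Icc (0 : ℝ) 1) →
      ∀ f : ℝ → ℝ, Continuous f → Integrable f ρ := by
    intro ρ _ hρ f hf
    obtain ⟨C, hC⟩ := isCompact_Icc.exists_bound_of_continuousOn (hf.continuousOn (s := Set.Icc 0 1))
    exact Integrable.of_bound hf.aestronglyMeasurable C (hρ.mono fun t ht => hC t ht)
  have hpoly : ∀ p : Polynomial ℝ, ∫ t, p.eval t ∂μ = ∫ t, p.eval t ∂ν := by
    intro p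
    simp only [Polynomial.eval_eq_sum_range]
    rw [integral_finsetSum _ fun i _ => hint hμ _ (by fun_prop),
      integral_finsetSum _ fun i _ => hint hν _ (by fun_prop)]
    simp only [integral_const_mul, h]
  refine ext_of_forall_integral_eq_of_IsFiniteMeasure fun f => ?_
  have hf : Continuous f := f.continuous
  refine eq_of_forall_dist_le fun η hη => ?_
  rw [Real.dist_eq]
  set M := μ.real Set.univ + ν.real Set.univ + 1
  have hM : 0 < M := by positivity
  obtain ⟨p, hp⟩ := exists_polynomial_near_of_continuousOn 0 1 f hf.continuousOn (η / M)
    (by positivity)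
  have hclose : ∀ {ρ : Measure ℝ} [IsFiniteMeasure ρ], (∀ᵐ t ∂ρ, t ∈ Set.Icc (0 : ℝ) 1) →
      |∫ t, p.eval t ∂ρ - ∫ t, f t ∂ρ| ≤ η / M * ρ.real Set.univ := by
    intro ρ _ hρ
    rw [← integral_sub (hint hρ _ (by fun_prop)) (hint hρ _ hf)]
    rw [← Real.norm_eq_abs]
    refine norm_integral_le_of_norm_le_const (hρ.mono fun t ht => ?_)
    exact (hp t ht).le
  have h1 := hclose hμ
  have h2 := hclose hν
  rw [hpoly p] at h1
  have h3 : η / M * μ.real Set.univ + η / M * ν.real Set.univ ≤ η := by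
    have : η / M * M = η := div_mul_cancel₀ _ hM.ne'
    have h4 : 0 < η / M := by positivity
    calc _ ≤ η / M * M := by simp only [M]; nlinarith
      _ = η := this
  rw [abs_le] at h1 h2 ⊢
  constructor <;> linarith [h1.1, h1.2, h2.1, h2.2]

/-! ### Binomial tails -/

/-- The derivative telescopes, since C(m, i + 1) (i + 1) = C(m, i) (m - i). -/
theorem hasDerivAt_binomialTail (m ζ : ℕ) (hζ : ζ + 1 ≤ m) (t : ℝ) :
    HasDerivAt (fun t : ℝ => ∑ i ∈ Finset.range (ζ + 1),
        (m.choose i : ℝ) * (1 - t) ^ i * t ^ (m - i))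
      ((m.choose (ζ + 1) : ℝ) * (t ^ (m - (ζ + 1)) * ((ζ + 1 : ℕ) * (1 - t) ^ ζ))) t := by
  have hsub : HasDerivAt (fun t : ℝ => 1 - t) (-1) t := by
    simpa using (hasDerivAt_id t).const_sub 1
  induction ζ with
  | zero =>
    simpa using hasDerivAt_pow m t
  | succ ζ ih =>
    simp only [Finset.sum_range_succ _ (ζ + 1)]
    have h1 := (((hsub.pow (ζ + 1)).const_mul (m.choose (ζ + 1) : ℝ)).mul
      (hasDerivAt_pow (m - (ζ + 1)) t))
    refine ((ih (by omega)).add h1).congr_deriv ?_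
    obtain ⟨r, rfl⟩ : ∃ r, m = r + (ζ + 2) := ⟨m - (ζ + 2), by omega⟩
    have e1 : r + (ζ + 2) - (ζ + 1) = r + 1 := by omega
    have e2 : r + (ζ + 2) - (ζ + 1 + 1) = r := by omega
    have hc := Nat.choose_succ_right_eq (r + (ζ + 2)) (ζ + 1)
    rw [e1] at hc
    have hc' : ((r + (ζ + 2)).choose (ζ + 1 + 1) : ℝ) * (ζ + 1 + 1) =
        ((r + (ζ + 2)).choose (ζ + 1) : ℝ) * (r + 1) := by exact_mod_cast hc
    rw [e1, e2]
    simp only [Nat.add_sub_cancel]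
    push_cast
    simp only [Pi.pow_apply]
    linear_combination (-(t ^ r * (1 - t) ^ (ζ + 1))) * hc'

/-- The density of the `Beta(1, ζ)` law of the probability of satisfaction. -/
theorem integral_binomialTail {m ζ : ℕ} (hζ : ζ + 1 ≤ m) (b : ℝ) :
    (m.choose (ζ + 1) : ℝ) * ∫ t in (0 : ℝ)..b, t ^ (m - (ζ + 1)) * ((ζ + 1 : ℕ) * (1 - t) ^ ζ) =
      ∑ i ∈ Finset.range (ζ + 1), (m.choose i : ℝ) * (1 - b) ^ i * b ^ (m - i) := by
  rw [← intervalIntegral.integral_const_mul,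
    intervalIntegral.integral_eq_sub_of_hasDerivAt
      (fun t _ => hasDerivAt_binomialTail m ζ hζ t)
      (Continuous.intervalIntegrable (by fun_prop) _ _)]
  rw [sub_eq_self]
  refine Finset.sum_eq_zero fun i hi => ?_
  have : m - i ≠ 0 := by have := Finset.mem_range.1 hi; omega
  simp [this]


/-! ### The law of the satisfaction probability -/

section Main

variable {n : ℕ} {Δ : Type*} [MeasurableSpace Δ] {P : Measure Δ} [IsProbabilityMeasure P]
  {X : Set (EuclideanSpace ℝ (Fin n))} {c : EuclideanSpace ℝ (Fin n)}
  {g : EuclideanSpace ℝ (Fin n) → Δ → ℝ}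
  {x : (m : ℕ) → (Fin m → Δ) → EuclideanSpace ℝ (Fin n)} {ζ : ℕ}

/-- Almost surely, every subprogram with at least `ζ` constraints has exactly `ζ` support
constraints. -/
theorem ae_card_support_subprogram
    (hsupp : ∀ m : ℕ, ζ ≤ m → ∀ᵐ ω ∂(Measure.pi fun _ : Fin m => P),
      {k : Fin m | IsSupportConstraint X c g ω k}.ncard = ζ) (m : ℕ) :
    ∀ᵐ ω ∂(Measure.pi fun _ : Fin m => P), ∀ J : Finset (Fin m), ζ ≤ J.card →
      (J.filter fun k => subValue X c g ω (J.erase k) < subValue X c g ω J).card = ζ := by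
  rw [ae_all_iff]
  intro J
  by_cases hJ : ζ ≤ J.card
  · have he := (J.orderEmbOfFin rfl).injective
    filter_upwards [ae_pi_comp_injective P he (hsupp J.card hJ)] with ω hω _
    rw [← hω]
    exact (ncard_isSupportConstraint_comp ω he (by simp)).symm
  · exact Filter.Eventually.of_forall fun ω h => absurd h hJ

/-- If almost surely there is no support constraint, the minimizer is almost surely never
violated. -/
theorem ae_violation_eq_zero (hconv : ConvexAssumption X c g)
    (hx : ∀ m : ℕ, 1 ≤ m → ∀ ω : Fin m → Δ, IsMinimizer X c g ω (x m ω))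
    (hsupp : ∀ m : ℕ, 0 ≤ m → ∀ᵐ ω ∂(Measure.pi fun _ : Fin m => P),
      {k : Fin m | IsSupportConstraint X c g ω k}.ncard = 0) {m : ℕ} (hm : 1 ≤ m) :
    ∀ᵐ ω ∂(Measure.pi fun _ : Fin m => P), P.real {δ | 0 < g (x m ω) δ} = 0 := by
  -- Sample `0` plays the fresh constraint; it is not a support constraint, so the minimizer for the
  -- others satisfies it.
  have h1 : ∀ᵐ ω ∂(Measure.pi fun _ : Fin (m + 1) => P),
      g (x m (ω ∘ Fin.succ)) (ω 0) ≤ 0 := by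
    filter_upwards [ae_card_support_subprogram hsupp (m + 1)] with ω hω
    have hrange : Set.range (ω ∘ Fin.succ) ⊆ Set.range ω := Set.range_comp_subset_range _ _
    have hfeas := (hx (m + 1) (by omega) ω).feasible_iff_optValue_eq hrange
      (hx m hm (ω ∘ Fin.succ)) fun z hz =>
        (hconv.existsUnique_minimizer m hm _).unique hz (hx m hm _)
    refine (hfeas.2 ?_).2 0
    rw [← subValue_univ, ← subValue_univ, ← subValue_image]
    have h0 := hω Finset.univ (Nat.zero_le _)
    rw [Finset.card_eq_zero, Finset.filter_eq_empty_iff] at h0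
    have : Finset.univ.image Fin.succ = (Finset.univ.erase 0 : Finset (Fin (m + 1))) := by
      ext i; simp
    rw [this]
    exact le_antisymm (subValue_mono ω (Finset.erase_subset _ _))
      (not_lt.1 (h0 (Finset.mem_univ 0)))
  have hmp := measurePreserving_piFinSuccAbove (fun _ : Fin (m + 1) => P) 0
  have h2 : ∀ᵐ p ∂((Measure.pi fun _ : Fin m => P).prod P), g (x m p.1) p.2 ≤ 0 := by
    have h3 : ∀ᵐ p ∂(P.prod (Measure.pi fun _ : Fin m => P)), g (x m p.2) p.1 ≤ 0 := by
      rw [← hmp.map_eq, (MeasurableEquiv.measurableEmbedding _).ae_map_iff]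
      exact h1
    have := (Measure.measurePreserving_swap (μ := Measure.pi fun _ : Fin m => P)
      (ν := P)).quasiMeasurePreserving.ae h3
    exact this
  filter_upwards [Measure.ae_ae_of_ae_prod h2] with ω hω
  rw [measureReal_eq_zero_iff]
  simpa [ae_iff] using hω

/-- Almost surely, exactly one set of `ζ` constraints has a minimizer that satisfies all the other
constraints, and this minimizer is the one of the whole program. -/
theorem ae_existsUnique_support (hconv : ConvexAssumption X c g)
    (hx : ∀ m : ℕ, 1 ≤ m → ∀ ω : Fin m → Δ, IsMinimizer X c g ω (x m ω))
    (hsupp : ∀ m : ℕ, ζ ≤ m → ∀ᵐ ω ∂(Measure.pi fun _ : Fin m => P),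
      {k : Fin m | IsSupportConstraint X c g ω k}.ncard = ζ)
    (hζ : 1 ≤ ζ) {m : ℕ} (hζm : ζ ≤ m) :
    ∀ᵐ ω ∂(Measure.pi fun _ : Fin m => P), ∃ E : Finset (Fin m), E.card = ζ ∧
      ∀ (I : Finset (Fin m)) (hI : I.card = ζ),
        ((∀ j ∉ I, g (x ζ (ω ∘ I.orderEmbOfFin hI)) (ω j) ≤ 0) ↔ I = E) ∧
        (I = E → x ζ (ω ∘ I.orderEmbOfFin hI) = x m ω) := by
  filter_upwards [ae_card_support_subprogram hsupp m] with ω hω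
  refine ⟨_, hω Finset.univ (by simpa using hζm), fun I hI => ?_⟩
  rw [← value_eq_iff_eq_essential (subValue_mono ω) (by simpa using hζm) hω hI]
  set e := I.orderEmbOfFin hI with he
  have hrange : Set.range (ω ∘ e) ⊆ Set.range ω := Set.range_comp_subset_range _ _
  have hfeas := (hx m (hζ.trans hζm) ω).feasible_iff_optValue_eq hrange (hx ζ hζ (ω ∘ e))
    fun z hz => (hconv.existsUnique_minimizer ζ hζ _).unique hz (hx ζ hζ _)
  have hval : subValue X c g ω I = optValue X c g (ω ∘ e) := by
    rw [← subValue_univ, ← subValue_image]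
    congr 1
    simp [he]
  rw [hval, subValue_univ, ← hfeas]
  refine ⟨⟨fun h => ⟨(hx ζ hζ (ω ∘ e)).1.1, fun i => ?_⟩, fun h j _ => h.2 j⟩, fun h => ?_⟩
  · by_cases hi : i ∈ I
    · obtain ⟨k, rfl⟩ : i ∈ Set.range e := by simpa [he] using hi
      exact (hx ζ hζ (ω ∘ e)).1.2 k
    · exact h i hi
  · exact (hconv.existsUnique_minimizer m (hζ.trans hζm) ω).unique
      ((hx ζ hζ (ω ∘ e)).of_feasible hrange h) (hx m (hζ.trans hζm) ω)

theorem measurable_satisfaction {k : ℕ}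
    (hmeas : MeasurableSet {p : (Fin k → Δ) × Δ | 0 < g (x k p.1) p.2}) :
    Measurable fun a : Fin k → Δ => P.real {δ | g (x k a) δ ≤ 0} := by
  have h := measurable_measure_prodMk_left (ν := P) hmeas.compl
  have : (fun a : Fin k → Δ => P.real {δ | g (x k a) δ ≤ 0}) = fun a =>
      (P (Prod.mk a ⁻¹' {p : (Fin k → Δ) × Δ | 0 < g (x k p.1) p.2}ᶜ)).toReal := by
    funext a
    rw [Measure.real]
    congr 2
    ext δ
    simp
  rw [this]
  exact h.ennreal_toReal

/-- The law of the satisfaction probability for `m` samples in terms of that for `ζ` samples. -/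
theorem measureReal_satisfaction_mem (hconv : ConvexAssumption X c g)
    (hx : ∀ m : ℕ, 1 ≤ m → ∀ ω : Fin m → Δ, IsMinimizer X c g ω (x m ω))
    (hmeas : ∀ m : ℕ, 1 ≤ m → MeasurableSet {p : (Fin m → Δ) × Δ | 0 < g (x m p.1) p.2})
    (hsupp : ∀ m : ℕ, ζ ≤ m → ∀ᵐ ω ∂(Measure.pi fun _ : Fin m => P),
      {k : Fin m | IsSupportConstraint X c g ω k}.ncard = ζ)
    (hζ : 1 ≤ ζ) {m : ℕ} (hζm : ζ ≤ m) {B : Set ℝ} (hB : MeasurableSet B) :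
    (Measure.pi fun _ : Fin m => P).real {ω | P.real {δ | g (x m ω) δ ≤ 0} ∈ B} =
      m.choose ζ * ∫ t in B, t ^ (m - ζ)
        ∂((Measure.pi fun _ : Fin ζ => P).map fun a => P.real {δ | g (x ζ a) δ ≤ 0}) := by
  have hW := measurable_satisfaction (P := P) (hmeas ζ hζ)
  set A : Set ((Fin ζ → Δ) × Δ) := {p | g (x ζ p.1) p.2 ≤ 0} with hA
  have hAm : MeasurableSet A := by
    have : A = {p : (Fin ζ → Δ) × Δ | 0 < g (x ζ p.1) p.2}ᶜ := by ext p; simp [hA]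
    exact this ▸ (hmeas ζ hζ).compl
  set S : Set (Fin ζ → Δ) := (fun a => P.real {δ | g (x ζ a) δ ≤ 0}) ⁻¹' B with hS
  have hSm : MeasurableSet S := hW hB
  -- The event that `I` is the distinguished index set, up to a null set, and the satisfaction
  -- probability lies in `B`.
  set F : {I : Finset (Fin m) // I.card = ζ} → Set (Fin m → Δ) := fun I =>
    {ω | ω ∘ I.1.orderEmbOfFin I.2 ∈ S ∧ ∀ j ∉ I.1, (ω ∘ I.1.orderEmbOfFin I.2, ω j) ∈ A} with hF
  have hFm : ∀ I, MeasurableSet (F I) := by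
    intro I
    have hcomp : Measurable fun ω : Fin m → Δ => ω ∘ I.1.orderEmbOfFin I.2 :=
      measurable_pi_lambda _ fun i => measurable_pi_apply _
    have : F I = ((fun ω => ω ∘ I.1.orderEmbOfFin I.2) ⁻¹' S) ∩
        ⋂ j, ⋂ _ : j ∉ I.1, (fun ω : Fin m → Δ => (ω ∘ I.1.orderEmbOfFin I.2, ω j)) ⁻¹' A := by
      ext ω; simp [hF]
    rw [this]
    exact (hcomp hSm).inter (MeasurableSet.iInter fun j => MeasurableSet.iInter fun _ =>
      (hcomp.prodMk (measurable_pi_apply j)) hAm)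
  have hae := ae_existsUnique_support hconv hx hsupp hζ hζm
  have hunion : {ω | P.real {δ | g (x m ω) δ ≤ 0} ∈ B}
      =ᵐ[Measure.pi fun _ : Fin m => P] ⋃ I, F I := by
    filter_upwards [hae] with ω ⟨E, hE, h⟩
    refine propext ?_
    change P.real {δ | g (x m ω) δ ≤ 0} ∈ B ↔ ω ∈ ⋃ I, F I
    rw [Set.mem_iUnion]
    constructor
    · intro hω
      refine ⟨⟨E, hE⟩, ?_, (h E hE).1.2 rfl⟩
      rw [hS, Set.mem_preimage, (h E hE).2 rfl]
      exact hω
    · rintro ⟨⟨I, hI⟩, h1, h2⟩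
      rw [← (h I hI).2 ((h I hI).1.1 h2)]
      exact h1
  have hdisj : Pairwise (Function.onFun (AEDisjoint (Measure.pi fun _ : Fin m => P)) F) := by
    intro I J hIJ
    refine measure_mono_null (t := {ω | ¬ _}) (fun ω hω => ?_) (ae_iff.1 hae)
    rintro ⟨E, hE, h⟩
    exact hIJ (Subtype.ext (((h I.1 I.2).1.1 hω.1.2).trans ((h J.1 J.2).1.1 hω.2.2).symm))
  rw [measureReal_congr hunion, Measure.real,
    measure_iUnion₀ hdisj fun I => (hFm I).nullMeasurableSet, tsum_fintype,
    ENNReal.toReal_sum fun _ _ => measure_ne_top _ _]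
  have hone : ∀ I : {I : Finset (Fin m) // I.card = ζ},
      ((Measure.pi fun _ : Fin m => P) (F I)).toReal = ∫ t in B, t ^ (m - ζ)
        ∂((Measure.pi fun _ : Fin ζ => P).map fun a => P.real {δ | g (x ζ a) δ ≤ 0}) := by
    intro I
    rw [setIntegral_map hB (by fun_prop) hW.aemeasurable]
    exact measure_pi_forall_notMem P I.2 hAm hSm
  rw [Finset.sum_congr rfl fun I _ => hone I, Finset.sum_const, nsmul_eq_mul]
  congr 2
  simp

/-- The law with density `ζ (1 - t) ^ (ζ - 1)` on the unit interval, written with `ζ = r + 1`. -/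
noncomputable def satisfactionLaw (r : ℕ) : Measure ℝ :=
  (volume.restrict (Set.Ioc (0 : ℝ) 1)).withDensity
    fun t => ENNReal.ofReal ((r + 1 : ℕ) * (1 - t) ^ r)

theorem setIntegral_satisfactionLaw (r k : ℕ) {b : ℝ} (hb0 : 0 ≤ b) (hb1 : b ≤ 1) :
    ∫ t in Set.Iic b, t ^ k ∂(satisfactionLaw r) =
      ∫ t in (0 : ℝ)..b, t ^ k * ((r + 1 : ℕ) * (1 - t) ^ r) := by
  rw [satisfactionLaw, restrict_withDensity measurableSet_Iic,
    Measure.restrict_restrict measurableSet_Iic,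
    integral_withDensity_eq_integral_toReal_smul (by fun_prop) (by simp),
    intervalIntegral.integral_of_le hb0]
  have : Set.Iic b ∩ Set.Ioc (0 : ℝ) 1 = Set.Ioc 0 b := by
    ext t
    simp only [Set.mem_inter_iff, Set.mem_Iic, Set.mem_Ioc]
    exact ⟨fun h => ⟨h.2.1, h.1⟩, fun h => ⟨h.2, h.1, h.2.trans hb1⟩⟩
  rw [this]
  refine setIntegral_congr_fun measurableSet_Ioc fun t ht => ?_
  have : 0 ≤ 1 - t := sub_nonneg.2 (ht.2.trans hb1)
  simp only [smul_eq_mul]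
  rw [ENNReal.toReal_ofReal (by positivity), mul_comm]

theorem ae_satisfactionLaw (r : ℕ) : ∀ᵐ t ∂(satisfactionLaw r), t ∈ Set.Ioc (0 : ℝ) 1 :=
  (withDensity_absolutelyContinuous _ _).ae_le (ae_restrict_mem measurableSet_Ioc)

instance isFiniteMeasure_satisfactionLaw (r : ℕ) : IsFiniteMeasure (satisfactionLaw r) := by
  refine isFiniteMeasure_withDensity_ofReal ?_
  exact ((Continuous.integrableOn_Icc (by fun_prop)).mono_set Set.Ioc_subset_Icc_self).2

/-- At `b = 1` only the `i = 0` term of the binomial tail survives. -/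
theorem integral_satisfactionLaw (r k : ℕ) :
    ((k + (r + 1)).choose (r + 1) : ℝ) * ∫ t, t ^ k ∂(satisfactionLaw r) = 1 := by
  have h := setIntegral_satisfactionLaw r k zero_le_one le_rfl
  rw [Measure.restrict_eq_self_of_ae_mem
    (s := Set.Iic 1) ((ae_satisfactionLaw r).mono fun t ht => ht.2)] at h
  have h2 := integral_binomialTail (m := k + (r + 1)) (ζ := r) (by omega) 1
  rw [Nat.add_sub_cancel] at h2
  rw [h, h2, Finset.sum_range_succ']
  simp

theorem map_satisfaction_eq (hconv : ConvexAssumption X c g)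
    (hx : ∀ m : ℕ, 1 ≤ m → ∀ ω : Fin m → Δ, IsMinimizer X c g ω (x m ω))
    (hmeas : ∀ m : ℕ, 1 ≤ m → MeasurableSet {p : (Fin m → Δ) × Δ | 0 < g (x m p.1) p.2})
    {r : ℕ} (hsupp : ∀ m : ℕ, r + 1 ≤ m → ∀ᵐ ω ∂(Measure.pi fun _ : Fin m => P),
      {k : Fin m | IsSupportConstraint X c g ω k}.ncard = r + 1) :
    ((Measure.pi fun _ : Fin (r + 1) => P).map fun a => P.real {δ | g (x (r + 1) a) δ ≤ 0}) =
      satisfactionLaw r := by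
  have hW := measurable_satisfaction (P := P) (hmeas (r + 1) (by omega))
  have := Measure.isProbabilityMeasure_map (μ := Measure.pi fun _ : Fin (r + 1) => P)
    hW.aemeasurable
  refine measure_ext_of_moments ?_ ?_ fun k => ?_
  · refine (ae_map_iff hW.aemeasurable measurableSet_Icc).2 ?_
    exact Filter.Eventually.of_forall fun a => ⟨measureReal_nonneg, measureReal_le_one⟩
  · exact (ae_satisfactionLaw r).mono fun t ht => Set.Ioc_subset_Icc_self ht
  · have h1 := measureReal_satisfaction_mem hconv hx hmeas hsupp (by omega)
      (Nat.le_add_left (r + 1) k) MeasurableSet.univ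
    rw [Nat.add_sub_cancel, Measure.restrict_univ] at h1
    simp only [Set.mem_univ, Set.ofPred_true, probReal_univ] at h1
    have hc : ((k + (r + 1)).choose (r + 1) : ℝ) ≠ 0 :=
      Nat.cast_ne_zero.2 (Nat.choose_pos (by omega)).ne'
    exact mul_left_cancel₀ hc (h1.symm.trans (integral_satisfactionLaw r k).symm)

end Main

end Scenario

theorem mainTheorem7 {n : ℕ} {Δ : Type*} [MeasurableSpace Δ]
    (P : Measure Δ) [IsProbabilityMeasure P]
    (X : Set (EuclideanSpace ℝ (Fin n))) (c : EuclideanSpace ℝ (Fin n))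
    (g : EuclideanSpace ℝ (Fin n) → Δ → ℝ)
    (hconv : Scenario.ConvexAssumption X c g)
    (x : (m : ℕ) → (Fin m → Δ) → EuclideanSpace ℝ (Fin n))
    (hx : ∀ m : ℕ, 1 ≤ m → ∀ ω : Fin m → Δ, Scenario.IsMinimizer X c g ω (x m ω))
    (hmeas : ∀ m : ℕ, 1 ≤ m →
      MeasurableSet {p : (Fin m → Δ) × Δ | 0 < g (x m p.1) p.2})
    (ζ : ℕ)
    (hsupp : ∀ m : ℕ, ζ ≤ m → ∀ᵐ ω ∂(Measure.pi fun _ : Fin m => P),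
      {k : Fin m | Scenario.IsSupportConstraint X c g ω k}.ncard = ζ)
    (m : ℕ) (hm : 1 ≤ m) (hζm : ζ ≤ m) (ε : ℝ) (hε0 : 0 < ε) (hε1 : ε < 1) :
    (Measure.pi fun _ : Fin m => P).real {ω | ε < P.real {δ | 0 < g (x m ω) δ}} =
      ∑ i ∈ Finset.range ζ, (m.choose i : ℝ) * ε ^ i * (1 - ε) ^ (m - i) := by
  rcases ζ with - | r
  · rw [Finset.sum_range_zero, measureReal_eq_zero_iff, ← compl_compl {ω | _}]
    refine (ae_iff (p := fun ω => ω ∈ _)).1 ?_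
    filter_upwards [Scenario.ae_violation_eq_zero hconv hx hsupp hm] with ω hω
    simp [hω, hε0.le]
  · have hcompl : ∀ ω : Fin m → Δ,
        P.real {δ | 0 < g (x m ω) δ} = 1 - P.real {δ | g (x m ω) δ ≤ 0} := by
      intro ω
      have hms : MeasurableSet {δ | 0 < g (x m ω) δ} :=
        measurable_prodMk_left (x := ω) (hmeas m hm)
      have := probReal_compl_eq_one_sub (μ := P) hms
      have hset : {δ | 0 < g (x m ω) δ}ᶜ = {δ | g (x m ω) δ ≤ 0} := by ext δ; simp
      rw [hset] at this
      linarith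
    have hevent : {ω | ε < P.real {δ | 0 < g (x m ω) δ}} =
        {ω | P.real {δ | g (x m ω) δ ≤ 0} ∈ Set.Iio (1 - ε)} := by
      ext ω
      simp only [Set.mem_ofPred_eq, Set.mem_Iio, hcompl]
      exact lt_sub_comm
    -- The strict event omits the endpoint, which has no mass under a law with a density.
    have hnull : Set.Iio (1 - ε) =ᵐ[Scenario.satisfactionLaw r] Set.Iic (1 - ε) :=
      (withDensity_absolutelyContinuous _ _).ae_le
        (Measure.absolutelyContinuous_of_le Measure.restrict_le_self |>.ae_le Iio_ae_eq_Iic)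
    rw [hevent, Scenario.measureReal_satisfaction_mem hconv hx hmeas hsupp (by omega) hζm
      measurableSet_Iio, Scenario.map_satisfaction_eq hconv hx hmeas hsupp,
      setIntegral_congr_set hnull,
      Scenario.setIntegral_satisfactionLaw r _ (by linarith) (by linarith),
      Scenario.integral_binomialTail hζm]
    simp only [sub_sub_cancel]
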